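/- Let $X$ be a connected, locally path connected topological space and let $x_0\in X$. Suppose that $X$ is a strong small loop transfer (strong SLT) space at $x_0$, that is: for every $x\in X$ and every neighbourhood $U$ of $x_0$ there is a neighbourhood $V$ of $x$ such that for every path $\alpha$ in $X$ from $x_0$ to $x$ and every loop $\beta$ in $V$ based at $x$ there is a loop $\gamma$ in $U$ based at $x_0$ that is homotopic to $\alpha*\beta*\alpha^{-1}$ relative to the endpoints. A continuous map $p:\widetilde X\to X$ is called a generalized covering map if $\widetilde X$ is connected and locally path connected and $p$ has the unique lifting property: for every $\tilde x\in\widetilde X$, every connected, locally path connected pointed space $(Y,y_0)$ and every continuous map $f:(Y,y_0)\to(X,p(\tilde x))$ with $f_*\pi_1(Y,y_0)\subseteq p_*\pi_1(\widetilde X,\tilde x)$, there is a unique continuous map $\tilde f:(Y,y_0)\to(\widetilde X,\tilde x)$ with $p\circ\tilde f=f$. A subgroup of $\pi_1(X,x_0)$ is called a generalized covering subgroup (respectively, a covering subgroup) if it equals $p_*\pi_1(\widetilde X,\tilde x_0)$ for some generalized covering map (respectively, some covering map with $\widetilde X$ connected) $p:\widetilde X\to X$ and some $\tilde x_0\in p^{-1}(x_0)$.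 Then a subgroup $H\le\pi_1(X,x_0)$ is a generalized covering subgroup if and only if $H$ is equal to the intersection of all covering subgroups of $\pi_1(X,x_0)$ that contain $H$. -/

import Mathlib

universe u

/-- `X` is a strong small loop transfer space at `x₀`: for every `x` and every neighbourhood `U`
of `x₀` there is a neighbourhood `V` of `x` such that for every path `α` from `x₀` to `x` and
every loop `β` in `V` based at `x`, some loop `γ` in `U` based at `x₀` is homotopic, relative to
the endpoints, to `α * β * α⁻¹`. -/
def IsStrongSLTAt {X : Type u} [TopologicalSpace X] (x₀ : X) : Prop :=
  ∀ x : X, ∀ U ∈ nhds x₀, ∃ V ∈ nhds x, ∀ (α : Path x₀ x) (β : Path x x),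
    Set.range β ⊆ V →
      ∃ γ : Path x₀ x₀, Set.range γ ⊆ U ∧ γ.Homotopic ((α.trans β).trans α.symm)

/-- The unique lifting property of a continuous map `p : E → X`: for every `e₀ : E`, every
connected, locally path connected pointed space `(Y, y₀)` and every continuous map
`f : (Y, y₀) → (X, p e₀)` with `f_* π₁(Y, y₀) ⊆ p_* π₁(E, e₀)`, there is a unique continuous
`g : (Y, y₀) → (E, e₀)` with `p ∘ g = f`. -/
def HasUniqueLiftingProperty {E X : Type u} [TopologicalSpace E] [TopologicalSpace X]
    (p : C(E, X)) : Prop :=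
  ∀ (Y : Type u) [TopologicalSpace Y] [ConnectedSpace Y] [LocallyPathConnectedSpace Y]
    (y₀ : Y) (e₀ : E) (f : C(Y, X)) (hf : f y₀ = p e₀),
    (FundamentalGroup.mapOfEq f hf).range ≤ (FundamentalGroup.map p e₀).range →
      ∃! g : C(Y, E), g y₀ = e₀ ∧ p.comp g = f

/-- A generalized covering map: a continuous map with the unique lifting property whose domain
is connected and locally path connected. -/
structure IsGeneralizedCoveringMap {E X : Type u} [TopologicalSpace E] [TopologicalSpace X]
    (p : C(E, X)) : Prop where
  connectedSpace : ConnectedSpace E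
  locallyPathConnectedSpace : LocallyPathConnectedSpace E
  hasUniqueLiftingProperty : HasUniqueLiftingProperty p

/-- `H ≤ π₁(X, x₀)` is a generalized covering subgroup if `H = p_* π₁(E, e₀)` for some
generalized covering map `p : (E, e₀) → (X, x₀)`. -/
def IsGeneralizedCoveringSubgroup {X : Type u} [TopologicalSpace X] {x₀ : X}
    (H : Subgroup (FundamentalGroup X x₀)) : Prop :=
  ∃ (E : Type u) (_ : TopologicalSpace E) (p : C(E, X)) (e₀ : E) (h : p e₀ = x₀),
    IsGeneralizedCoveringMap p ∧ (FundamentalGroup.mapOfEq p h).range = H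

/-- `K ≤ π₁(X, x₀)` is a covering subgroup if `K = p_* π₁(E, e₀)` for some covering map
`p : (E, e₀) → (X, x₀)` with `E` connected. -/
def IsCoveringSubgroup {X : Type u} [TopologicalSpace X] {x₀ : X}
    (K : Subgroup (FundamentalGroup X x₀)) : Prop :=
  ∃ (E : Type u) (_ : TopologicalSpace E) (p : C(E, X)) (e₀ : E) (h : p e₀ = x₀),
    ConnectedSpace E ∧ IsCoveringMap p ∧ (FundamentalGroup.mapOfEq p h).range = K

/-!
Let `P` be the space of paths in `X` from `x₀`, with the topology generated by the path components
of the open sets of the compact-open topology; it is contractible and locally path connected. Hence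
a map `p : E → X` with unique lifting lifts the endpoint map `P → X` to a map `L : P → E`, which
sends a path to the endpoint of its lift. Conversely, such an `L` determines all lifts along `p`,
because `P` of any path connected, locally path connected space has that space as a quotient.

For a subgroup `K` of `π₁(X, x₀)`, let `P / K` identify paths that differ by an element of `K`. If
`K` is the intersection of the images of `p i : E i → X`, a path in `P / K` is mapped to each `E i`,
so its endpoint is determined by its projection to `X`. Thus an intersection of generalized covering
subgroups is again one, and covering subgroups are generalized covering subgroups. If every point
of `X` has a neighbourhood whose loops, transferred to `x₀`, have their classes in `K`, then `P / K`
is a covering of `X`.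

In a strong SLT space this holds whenever `K` contains the classes of the loops in a neighbourhood
`U` of `x₀`, in particular for `K = N H`, where `N` is the normal closure of the classes of the
loops in a neighbourhood of `x₀`; moreover `N` consists of classes of loops in `U` once that
neighbourhood is small enough. So if `g` lies in every covering subgroup that contains `H`, then
`g = n h` with `n` the class of an arbitrarily small loop and `h` in `H`. If `H` comes from
`p : E → X`, the lifts of `g` and of `n` end at the same point, which therefore specializes to the
base point `e₀`. Jumping from `e₀` to that point is then continuous, and uniqueness of lifts of the
constant path shows that the two points agree, so that `g` is in `H`.
-/

open Topology unitInterval Filter Set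

instance : LocallyPathConnectedSpace I := (convex_Icc (0 : ℝ) 1).locallyPathConnectedSpace

/-- A space with the topology generated by the path components of its open subsets. -/
@[ext]
structure LocalPathRefinement (Z : Type*) where
  of ::
  val : Z

namespace LocalPathRefinement

variable {Y Z : Type*} [TopologicalSpace Y] [TopologicalSpace Z]

instance : TopologicalSpace (LocalPathRefinement Z) :=
  .generateFrom {S | ∃ (U : Set Z) (z : Z), IsOpen U ∧ S = val ⁻¹' pathComponentIn U z}

theorem isOpen_preimage_pathComponentIn {U : Set Z} (hU : IsOpen U) (z : Z) :
    IsOpen (val ⁻¹' pathComponentIn U z : Set (LocalPathRefinement Z)) :=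
  TopologicalSpace.isOpen_generateFrom_of_mem ⟨U, z, hU, rfl⟩

theorem continuous_val : Continuous (val : LocalPathRefinement Z → Z) :=
  ⟨fun _ hU ↦ isOpen_iff_mem_nhds.2 fun z hz ↦
    mem_of_superset ((isOpen_preimage_pathComponentIn hU (val z)).mem_nhds
      (mem_pathComponentIn_self hz)) (preimage_mono pathComponentIn_subset)⟩

theorem continuous_of_comp [LocallyPathConnectedSpace Y] {f : Y → Z} (hf : Continuous f) :
    Continuous fun y ↦ of (f y) := by
  refine continuous_generateFrom_iff.2 ?_
  rintro _ ⟨U, z, hU, rfl⟩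
  refine isOpen_iff_mem_nhds.2 fun y hy ↦ ?_
  have hy' : f y ∈ pathComponentIn U z := hy
  have hyU : f y ∈ U := pathComponentIn_subset hy'
  refine mem_of_superset (((hU.preimage hf).pathComponentIn y).mem_nhds
    (mem_pathComponentIn_self hyU)) fun y' h ↦ ?_
  change f y' ∈ pathComponentIn U z
  rw [← pathComponentIn_congr hy']
  exact (JoinedIn.map h hf).mono (image_preimage_subset _ _)

theorem exists_pathComponentIn_subset {S : Set (LocalPathRefinement Z)} (hS : IsOpen S)
    {z : LocalPathRefinement Z} (hz : z ∈ S) :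
    ∃ U : Set Z, IsOpen U ∧ val z ∈ U ∧ val ⁻¹' pathComponentIn U (val z) ⊆ S := by
  induction hS with
  | basic S h =>
    obtain ⟨U, w, hU, rfl⟩ := h
    refine ⟨U, hU, pathComponentIn_subset hz, ?_⟩
    rw [pathComponentIn_congr (show val z ∈ pathComponentIn U w from hz)]
  | univ => exact ⟨univ, isOpen_univ, trivial, subset_univ _⟩
  | inter S S' _ _ ih ih' =>
    obtain ⟨U, hU, hzU, h⟩ := ih hz.1
    obtain ⟨U', hU', hzU', h'⟩ := ih' hz.2
    exact ⟨U ∩ U', hU.inter hU', ⟨hzU, hzU'⟩, subset_inter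
      ((preimage_mono (pathComponentIn_mono inter_subset_left)).trans h)
      ((preimage_mono (pathComponentIn_mono inter_subset_right)).trans h')⟩
  | sUnion 𝒮 _ ih =>
    obtain ⟨S, hS, hzS⟩ := hz
    obtain ⟨U, hU, hzU, h⟩ := ih S hS hzS
    exact ⟨U, hU, hzU, h.trans (subset_sUnion_of_mem hS)⟩

instance : LocallyPathConnectedSpace (LocalPathRefinement Z) := by
  rw [locallyPathConnectedSpace_iff_pathComponentIn_mem_nhds]
  intro z S hS hz
  obtain ⟨U, hU, hzU, h⟩ := exists_pathComponentIn_subset hS hz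
  refine mem_of_superset ((isOpen_preimage_pathComponentIn hU (val z)).mem_nhds
    (mem_pathComponentIn_self hzU)) fun w hw ↦ ?_
  have hw' : JoinedIn (pathComponentIn U (val z)) (val z) (val w) :=
    (isPathConnected_pathComponentIn hzU).joinedIn _ (mem_pathComponentIn_self hzU) _ hw
  obtain ⟨δ, hδ⟩ := hw'
  exact ⟨⟨⟨fun t ↦ of (δ t), continuous_of_comp δ.continuous⟩, LocalPathRefinement.ext δ.source,
    LocalPathRefinement.ext δ.target⟩, fun t ↦ h (hδ t)⟩

end LocalPathRefinement

/-- The space of the paths in `X` that start at `x₀`. It carries the locally path connected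
refinement of the compact-open topology, so that maps out of it can be lifted. -/
def BasedPath {X : Type*} [TopologicalSpace X] (x₀ : X) :=
  LocalPathRefinement {γ : C(I, X) // γ 0 = x₀}

namespace BasedPath

variable {X Y : Type*} [TopologicalSpace X] [TopologicalSpace Y] {x₀ x y : X}

instance : TopologicalSpace (BasedPath x₀) :=
  inferInstanceAs (TopologicalSpace (LocalPathRefinement _))

instance : LocallyPathConnectedSpace (BasedPath x₀) :=
  inferInstanceAs (LocallyPathConnectedSpace (LocalPathRefinement _))

/-- A path from `x₀`, as a point of the based path space. -/
def of (γ : Path x₀ x) : BasedPath x₀ :=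
  LocalPathRefinement.of ⟨γ, γ.source⟩

theorem continuous_eval : Continuous fun z : BasedPath x₀ × I ↦ z.1.val.1 z.2 :=
  ContinuousEval.continuous_eval.comp
    ((continuous_subtype_val.comp LocalPathRefinement.continuous_val).prodMap continuous_id)

variable (x₀) in
/-- The evaluation of based paths at time `1`. -/
def endpoint : C(BasedPath x₀, X) where
  toFun γ := γ.val.1 1
  continuous_toFun := continuous_eval.comp (by fun_prop : Continuous fun γ ↦ (γ, (1 : I)))

/-- A point of the based path space, as a path from `x₀` to its endpoint. -/
def path (γ : BasedPath x₀) : Path x₀ (endpoint x₀ γ) :=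
  ⟨γ.val.1, γ.val.2, rfl⟩

@[simp]
theorem endpoint_of (γ : Path x₀ x) : endpoint x₀ (of γ) = x := γ.target

@[simp]
theorem path_of_apply (γ : Path x₀ x) (t : I) : (of γ).path t = γ t := rfl

theorem ext {γ γ' : BasedPath x₀} (h : ∀ t, γ.path t = γ'.path t) : γ = γ' :=
  LocalPathRefinement.ext (Subtype.ext (ContinuousMap.ext h))

theorem path_congr {γ γ' : BasedPath x₀} (h : γ = γ') (t : I) : γ.path t = γ'.path t := by
  rw [h]

theorem exists_eq_of (γ : BasedPath x₀) (hγ : endpoint x₀ γ = x) : ∃ α : Path x₀ x, of α = γ :=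
  ⟨γ.path.cast rfl hγ.symm, rfl⟩

theorem continuous_of_continuous_uncurry [LocallyPathConnectedSpace Y] {f : Y → BasedPath x₀}
    (hf : Continuous fun z : Y × I ↦ (f z.1).path z.2) : Continuous f :=
  LocalPathRefinement.continuous_of_comp (f := fun y ↦ (f y).val)
    ((ContinuousMap.curry ⟨_, hf⟩).continuous.subtype_mk fun y ↦ (f y).val.2)

/-- The part of a based path up to time `s`, parametrized by the unit interval. -/
def initial (γ : BasedPath x₀) (s : I) : BasedPath x₀ :=
  of (x := γ.path s) ⟨⟨fun t ↦ γ.path (s * t), by fun_prop⟩, by simp, by simp⟩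

@[simp]
theorem path_initial_apply (γ : BasedPath x₀) (s t : I) :
    (γ.initial s).path t = γ.path (s * t) := rfl

@[simp]
theorem endpoint_initial (γ : BasedPath x₀) (s : I) :
    endpoint x₀ (γ.initial s) = γ.path s :=
  congrArg γ.path (mul_one s)

@[simp]
theorem initial_zero (γ : BasedPath x₀) : γ.initial 0 = of (.refl x₀) :=
  ext fun t ↦ by simp

@[simp]
theorem initial_one (γ : BasedPath x₀) : γ.initial 1 = γ :=
  ext fun t ↦ by simp

theorem continuous_initial : Continuous fun z : I × BasedPath x₀ ↦ z.2.initial z.1 :=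
  continuous_of_continuous_uncurry (continuous_eval.comp
    (by fun_prop : Continuous fun w : (I × BasedPath x₀) × I ↦ (w.1.2, w.1.1 * w.2)))

instance : ContractibleSpace (BasedPath x₀) :=
  (contractible_iff_id_nullhomotopic _).2 ⟨of (.refl x₀), .symm
    ⟨⟨⟨_, continuous_initial⟩, initial_zero, initial_one⟩⟩⟩

/-- Prolongation of the paths from `y` by a path from `x` to `y`. -/
noncomputable def trans (α : Path x y) : C(BasedPath y, BasedPath x) where
  toFun ε := of (α.trans ε.path)
  continuous_toFun := continuous_of_continuous_uncurry <|
    Path.trans_continuous_family (fun _ : BasedPath y ↦ α)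
      (α.continuous.comp continuous_snd) (fun ε ↦ ε.path) continuous_eval

theorem trans_of {z : X} (α : Path x y) (β : Path y z) : trans α (of β) = of (α.trans β) :=
  ext fun t ↦ show (α.trans (of β).path) t = (α.trans β) t by
    simp only [Path.trans_apply, path_of_apply]

@[simp]
theorem endpoint_trans (α : Path x y) (ε : BasedPath y) :
    endpoint x (trans α ε) = endpoint y ε :=
  (α.trans ε.path).target

/-- The map of based path spaces induced by a continuous map. -/
def map (f : C(X, Y)) {y₀ : Y} (h : f x₀ = y₀) : C(BasedPath x₀, BasedPath y₀) where
  toFun γ := of ((γ.path.map f.continuous).cast h.symm rfl)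
  continuous_toFun := continuous_of_continuous_uncurry (f.continuous.comp continuous_eval)

@[simp]
theorem endpoint_map (f : C(X, Y)) {y₀ : Y} (h : f x₀ = y₀) (γ : BasedPath x₀) :
    endpoint y₀ (map f h γ) = f (endpoint x₀ γ) := rfl

@[simp]
theorem map_refl (f : C(X, Y)) {y₀ : Y} (h : f x₀ = y₀) :
    map f h (of (.refl x₀)) = of (.refl y₀) :=
  ext fun _ ↦ h

theorem map_trans (f : C(X, Y)) (α : Path x y) (ε : BasedPath y) :
    map f rfl (trans α ε) = trans (α.map f.continuous) (map f rfl ε) :=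
  congrArg (of (x := f (endpoint y ε))) (Path.map_trans ..)

/-- The paths that stay in an open neighbourhood of `x₀` form a star-shaped, hence path connected,
set that is open in the compact-open topology. -/
theorem exists_forall_of_mem {O : Set (BasedPath x₀)} (hO : O ∈ 𝓝 (of (.refl x₀))) :
    ∃ U ∈ 𝓝 x₀, ∀ γ : BasedPath x₀, range γ.path ⊆ U → γ ∈ O := by
  obtain ⟨O', hO', hO'_open, hmem⟩ := mem_nhds_iff.1 hO
  obtain ⟨W, hW, hreflW, hWO⟩ := LocalPathRefinement.exists_pathComponentIn_subset hO'_open hmem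
  obtain ⟨W', hW', rfl⟩ := isOpen_induced_iff.1 hW
  have hsmall : Tendsto id (comap (fun f : C(I, X) ↦ range f) (𝓝 x₀).smallSets)
      (𝓝 (.const I x₀)) :=
    ContinuousMap.tendsto_nhds_compactOpen.2 fun K _ U hU hKU ↦ by
      obtain rfl | ⟨s, hs⟩ := K.eq_empty_or_nonempty
      · simp only [mapsTo_empty, eventually_true]
      filter_upwards [tendsto_comap.eventually (eventually_smallSets_subset.2
        (hU.mem_nhds (hKU hs)))] with f hf t _ using hf (mem_range_self t)
  obtain ⟨t, ht, htW⟩ := hsmall (hW'.mem_nhds hreflW)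
  obtain ⟨U, hU, hUt⟩ := eventually_smallSets.1 ht
  refine ⟨U, hU, fun γ hγ ↦ hO' (hWO ?_)⟩
  have hγW (s : I) : (γ.initial s).val ∈ Subtype.val ⁻¹' W' :=
    htW (hUt _ ((range_subset_range_iff_exists_comp.2 ⟨fun t ↦ s * t, rfl⟩).trans hγ))
  have hcont : Continuous fun s : I ↦ (γ.initial s).val :=
    LocalPathRefinement.continuous_val.comp (continuous_initial.comp
      (by fun_prop : Continuous fun s : I ↦ (s, γ)))
  exact ⟨⟨⟨_, hcont⟩, congrArg LocalPathRefinement.val γ.initial_zero,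
    congrArg LocalPathRefinement.val γ.initial_one⟩, hγW⟩

theorem map_endpoint_nhds_refl [LocallyPathConnectedSpace X] (x₀ : X) :
    Filter.map (endpoint x₀) (𝓝 (of (.refl x₀))) = 𝓝 x₀ := by
  refine le_antisymm ((endpoint x₀).continuousAt (of (.refl x₀))) fun S hS ↦ ?_
  obtain ⟨U, hU, hUS⟩ := exists_forall_of_mem hS
  refine mem_of_superset (pathComponentIn_mem_nhds hU) fun x hx ↦ ?_
  obtain ⟨δ, hδ⟩ : JoinedIn U x₀ x := hx
  simpa using hUS (of δ) (range_subset_iff.2 hδ)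

theorem isQuotientMap_endpoint [PathConnectedSpace X] [LocallyPathConnectedSpace X] (x₀ : X) :
    IsQuotientMap (endpoint x₀) := by
  refine ⟨isCoinducing_iff.2 fun S ↦ ⟨fun hS ↦ isOpen_iff_mem_nhds.2 fun x hx ↦ ?_,
    (·.preimage (endpoint x₀).continuous)⟩,
    fun x ↦ ⟨of (PathConnectedSpace.somePath x₀ x), endpoint_of _⟩⟩
  let α := PathConnectedSpace.somePath x₀ x
  have hαS : endpoint x ⁻¹' S = trans α ⁻¹' (endpoint x₀ ⁻¹' S) := by
    ext ε
    simp
  rw [← map_endpoint_nhds_refl, Filter.mem_map, hαS]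
  exact (hS.preimage (trans α).continuous).mem_nhds (by simpa using hx)

/-- The initial parts of `γ` form a path in the based path space, whose endpoints trace out `γ`;
the based path space is simply connected. -/
theorem path_trans_map_endpoint_homotopic {γ γ' : BasedPath x₀} (Γ : Path γ γ') :
    (γ.path.trans (Γ.map (endpoint x₀).continuous)).Homotopic γ'.path := by
  let initials (γ : BasedPath x₀) : Path (of (.refl x₀)) γ :=
    ⟨⟨fun s ↦ γ.initial s, continuous_initial.comp (by fun_prop : Continuous fun s : I ↦ (s, γ))⟩,
      initial_zero γ, initial_one γ⟩
  have htrace (γ : BasedPath x₀) :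
      (initials γ).map (endpoint x₀).continuous = γ.path.cast (endpoint_of _) rfl :=
    Path.ext (funext (endpoint_initial γ))
  have := (SimplyConnectedSpace.paths_homotopic ((initials γ).trans Γ) (initials γ')).map
    (endpoint x₀)
  rw [Path.map_trans, htrace, htrace] at this
  exact this

end BasedPath

/-! ### Endpoints of lifts -/

section FundamentalGroup

variable {E X : Type*} [TopologicalSpace E] [TopologicalSpace X]

theorem map_eq_mapOfEq_rfl (f : C(E, X)) (e : E) :
    FundamentalGroup.map f e = FundamentalGroup.mapOfEq f rfl :=
  MonoidHom.ext fun a ↦ by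
    rw [FundamentalGroup.mapOfEq_apply]
    exact (Path.Homotopic.Quotient.cast_rfl_rfl _).symm

theorem mk_mem_range_mapOfEq_iff (f : C(E, X)) {e : E} {x : X} (h : f e = x) (γ : Path x x) :
    FundamentalGroup.fromPath (.mk γ) ∈ (FundamentalGroup.mapOfEq f h).range ↔
      ∃ β : Path e e, ((β.map f.continuous).cast h.symm h.symm).Homotopic γ := by
  constructor
  · rintro ⟨b, hb⟩
    obtain ⟨β, rfl⟩ := Path.Homotopic.Quotient.mk_surjective b
    rw [FundamentalGroup.mapOfEq_apply] at hb
    exact ⟨β, Path.Homotopic.Quotient.exact hb⟩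
  · rintro ⟨β, hβ⟩
    refine ⟨FundamentalGroup.fromPath (.mk β), ?_⟩
    rw [FundamentalGroup.mapOfEq_apply]
    exact Path.Homotopic.Quotient.eq.2 hβ

end FundamentalGroup

/-- `L` computes endpoints of lifts along `p`: it sends a path in `X` to the endpoint of its
unique lift that starts at `e₀`. By `comp_map` there is at most one lift, and by `comp_eq` the
point that `L` selects lies over the endpoint of the path. -/
structure IsEndpointLift {E X : Type*} [TopologicalSpace E] [TopologicalSpace X] (p : C(E, X))
    {e₀ : E} {x₀ : X} (h : p e₀ = x₀) (L : C(BasedPath x₀, E)) : Prop where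
  comp_eq : p.comp L = BasedPath.endpoint x₀
  comp_map : L.comp (BasedPath.map p h) = BasedPath.endpoint e₀

namespace IsEndpointLift

open BasedPath

variable {E X : Type*} [TopologicalSpace E] [TopologicalSpace X] {p : C(E, X)} {e₀ : E}
  {x₀ x : X} {h : p e₀ = x₀} {L : C(BasedPath x₀, E)}

theorem apply_apply (hL : IsEndpointLift p h L) (γ : BasedPath x₀) :
    p (L γ) = endpoint x₀ γ :=
  DFunLike.congr_fun hL.comp_eq γ

theorem apply_map (hL : IsEndpointLift p h L) (Γ : BasedPath e₀) :
    L (map p h Γ) = endpoint e₀ Γ :=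
  DFunLike.congr_fun hL.comp_map Γ

theorem apply_refl (hL : IsEndpointLift p h L) : L (of (.refl x₀)) = e₀ := by
  simpa using hL.apply_map (of (.refl e₀))

theorem comp_trans (hL : IsEndpointLift p h L) {e : E} (δ : Path e₀ e) :
    IsEndpointLift p rfl (L.comp (trans ((δ.map p.continuous).cast h.symm rfl))) := by
  subst h
  refine ⟨ContinuousMap.ext fun ε ↦ ?_, ContinuousMap.ext fun Γ ↦ ?_⟩
  · exact (hL.apply_apply _).trans (endpoint_trans _ ε)
  · exact (congrArg L (map_trans p δ Γ)).symm.trans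
      ((hL.apply_map _).trans (endpoint_trans δ Γ))

theorem exists_map_eq (hL : IsEndpointLift p h L) (γ : BasedPath x₀) :
    ∃ Γ : Path e₀ (L γ), map p h (of Γ) = γ := by
  refine ⟨⟨⟨fun t ↦ L (γ.initial t), ?_⟩, ?_, ?_⟩, ext fun t ↦ ?_⟩
  · exact L.continuous.comp (continuous_initial.comp (by fun_prop : Continuous fun t : I ↦ (t, γ)))
  · exact (congrArg L (initial_zero _)).trans hL.apply_refl
  · exact congrArg L (initial_one _)
  · exact (hL.apply_apply _).trans (endpoint_initial _ _)

theorem endpoint_eq_of_map_eq (hL : IsEndpointLift p h L) {γ : BasedPath x₀}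
    {Γ Γ' : BasedPath (L γ)} (hΓ : map p rfl Γ = map p rfl Γ') :
    endpoint (L γ) Γ = endpoint (L γ) Γ' := by
  obtain ⟨δ, -⟩ := hL.exists_map_eq γ
  rw [← (hL.comp_trans δ).apply_map, ← (hL.comp_trans δ).apply_map]
  exact congrArg _ hΓ

/-- The lifts of the paths of a homotopy end along a path that projects to a constant path. -/
theorem apply_eq_of_homotopic (hL : IsEndpointLift p h L) {γ γ' : Path x₀ x}
    (H : γ.Homotopic γ') : L (of γ) = L (of γ') := by
  obtain ⟨F⟩ := H
  have hF : Continuous fun s ↦ of (F.eval s) := continuous_of_continuous_uncurry F.continuous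
  let ends : Path (L (of γ)) (L (of γ')) :=
    ⟨⟨fun s ↦ L (of (F.eval s)), L.continuous.comp hF⟩, by simp, by simp⟩
  have hconst : map p rfl (of ends) = map p rfl (of (.refl (L (of γ)))) := ext fun s ↦ by
    change p (L (of (F.eval s))) = p (L (of γ))
    simp only [hL.apply_apply, endpoint_of]
  simpa using (hL.endpoint_eq_of_map_eq hconst).symm

theorem apply_eq_apply_iff (hL : IsEndpointLift p h L) {γ γ' : Path x₀ x} :
    L (of γ) = L (of γ') ↔
      FundamentalGroup.fromPath (.mk (γ.trans γ'.symm)) ∈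
        (FundamentalGroup.mapOfEq p h).range := by
  rw [mk_mem_range_mapOfEq_iff]
  subst h
  obtain ⟨Γ', hΓ'⟩ := hL.exists_map_eq (of γ')
  constructor
  · intro heq
    obtain ⟨Γ, hΓ⟩ := hL.exists_map_eq (of γ)
    refine ⟨Γ.trans (Γ'.cast rfl heq).symm, ?_⟩
    convert Path.Homotopic.refl (γ.trans γ'.symm) using 1
    ext t
    have hΓt (t : I) : p (Γ t) = γ t := path_congr hΓ t
    have hΓt' (t : I) : p (Γ' t) = γ' t := path_congr hΓ' t
    change p ((Γ.trans (Γ'.cast rfl heq).symm) t) = _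
    rw [Path.trans_apply, Path.trans_apply]
    split_ifs
    · exact hΓt _
    · exact hΓt' _
  · rintro ⟨β, hβ⟩
    have hγ : γ.Homotopic ((β.map p.continuous).trans γ') := by
      rw [← Path.Homotopic.Quotient.eq, Path.cast_rfl_rfl, Path.Homotopic.Quotient.mk_trans,
        Path.Homotopic.Quotient.mk_symm] at hβ
      rw [← Path.Homotopic.Quotient.eq, Path.Homotopic.Quotient.mk_trans, hβ]
      grind
    rw [hL.apply_eq_of_homotopic hγ, ← BasedPath.trans_of, ← hΓ', ← map_trans, hL.apply_map,
      hL.apply_map, endpoint_trans]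

theorem apply_eq_iff (hL : IsEndpointLift p h L) {γ : Path x₀ x₀} :
    L (of γ) = e₀ ↔ FundamentalGroup.fromPath (.mk γ) ∈ (FundamentalGroup.mapOfEq p h).range := by
  have htrans_refl : Path.Homotopic.Quotient.mk (γ.trans (Path.refl x₀).symm) = .mk γ := by
    simp
  rw [← htrans_refl, ← hL.apply_eq_apply_iff, hL.apply_refl]

/-- The path jumps from `e₀` to `e` immediately after time `0`; it is continuous because `e`
specializes to `e₀`. -/
theorem eq_of_specializes (hL : IsEndpointLift p h L) {e : E} (he : e ⤳ e₀) (hp : p e = x₀) :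
    e = e₀ := by
  classical
  have hjump : Continuous (({0} : Set I).piecewise (fun _ ↦ e₀) fun _ ↦ e) :=
    isClosed_singleton.continuous_piecewise_of_specializes continuous_const continuous_const
      fun _ ↦ he
  let jump : Path e₀ e := ⟨⟨_, hjump⟩, by simp, by simp⟩
  have hmap : map p h (of jump) = of (.refl x₀) := ext fun t ↦ by
    change p (({0} : Set I).piecewise (fun _ ↦ e₀) (fun _ ↦ e) t) = x₀
    by_cases ht : t ∈ ({0} : Set I)
    · rw [piecewise_eq_of_mem _ _ _ ht, h]
    · rw [piecewise_eq_of_notMem _ _ _ ht, hp]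
  rw [← endpoint_of jump, ← hL.apply_map, hmap, hL.apply_refl]

theorem existsUnique_lift {L : C(BasedPath (p e₀), E)} (hL : IsEndpointLift p rfl L)
    {Y : Type*} [TopologicalSpace Y] [PathConnectedSpace Y] [LocallyPathConnectedSpace Y]
    {y₀ : Y} (f : C(Y, X)) (hf : f y₀ = p e₀)
    (hle : (FundamentalGroup.mapOfEq f hf).range ≤ (FundamentalGroup.map p e₀).range) :
    ∃! g : C(Y, E), g y₀ = e₀ ∧ p.comp g = f := by
  have hfactor (η η' : BasedPath y₀) (hη : endpoint y₀ η = endpoint y₀ η') :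
      L (map f hf η) = L (map f hf η') := by
    obtain ⟨α, rfl⟩ := η.exists_eq_of hη
    rw [map_eq_mapOfEq_rfl] at hle
    refine (hL.apply_eq_apply_iff (γ := (α.map f.continuous).cast hf.symm rfl)
      (γ' := (η'.path.map f.continuous).cast hf.symm rfl)).2
        (hle ((mk_mem_range_mapOfEq_iff f hf _).2 ⟨α.trans η'.path.symm, ?_⟩))
    rw [Path.map_trans]
    rfl
  let g : C(Y, E) := (isQuotientMap_endpoint y₀).lift (L.comp (map f hf)) hfactor
  have hg (η : BasedPath y₀) : g (endpoint y₀ η) = L (map f hf η) :=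
    DFunLike.congr_fun ((isQuotientMap_endpoint y₀).lift_comp (L.comp (map f hf)) hfactor) η
  refine ⟨g, ⟨?_, ?_⟩, ?_⟩
  · simpa [hL.apply_refl] using hg (of (.refl y₀))
  · ext y
    obtain ⟨η, rfl⟩ := (isQuotientMap_endpoint y₀).surjective y
    exact (congrArg p (hg η)).trans (hL.apply_apply _)
  · rintro g' ⟨hg'₀, rfl⟩
    ext y
    obtain ⟨η, rfl⟩ := (isQuotientMap_endpoint y₀).surjective y
    exact (hL.apply_map (map g' hg'₀ η)).symm.trans (hg η).symm

theorem of_isCoveringMap (hp : IsCoveringMap p) (hL : p.comp L = endpoint x₀)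
    (hL₀ : L (of (.refl x₀)) = e₀) : IsEndpointLift p h L := by
  refine ⟨hL, DFunLike.coe_injective (hp.eq_of_comp_eq (map_continuous _) (map_continuous _) ?_
    (of (.refl e₀)) ?_)⟩
  · exact funext fun Γ ↦ DFunLike.congr_fun hL (map p h Γ)
  · simpa using hL₀

end IsEndpointLift

section UniqueLifting

open BasedPath

variable {E X : Type u} [TopologicalSpace E] [TopologicalSpace X] {p : C(E, X)} {e₀ : E}

namespace HasUniqueLiftingProperty

theorem existsUnique_lift_of_simplyConnected (hp : HasUniqueLiftingProperty p) {Y : Type u}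
    [TopologicalSpace Y] [SimplyConnectedSpace Y] [LocallyPathConnectedSpace Y] {y₀ : Y}
    {f : C(Y, X)} (hf : f y₀ = p e₀) : ∃! g : C(Y, E), g y₀ = e₀ ∧ p.comp g = f :=
  hp Y y₀ e₀ f hf <| by
    rintro _ ⟨a, rfl⟩
    rw [Subsingleton.elim a 1, map_one]
    exact one_mem _

theorem exists_isEndpointLift (hp : HasUniqueLiftingProperty p) {x₀ : X} (h : p e₀ = x₀) :
    ∃ L : C(BasedPath x₀, E), IsEndpointLift p h L := by
  subst h
  obtain ⟨L, ⟨hL₀, hL⟩, -⟩ := hp.existsUnique_lift_of_simplyConnected (y₀ := of (.refl (p e₀)))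
    (f := endpoint (p e₀)) (endpoint_of _)
  refine ⟨L, hL, (hp.existsUnique_lift_of_simplyConnected (y₀ := of (.refl e₀))
    (f := p.comp (endpoint e₀)) (congrArg p (endpoint_of _))).unique ⟨?_, ?_⟩
    ⟨endpoint_of _, rfl⟩⟩
  · simpa using hL₀
  · rw [← ContinuousMap.comp_assoc, hL]
    rfl

end HasUniqueLiftingProperty

namespace IsEndpointLift

theorem isGeneralizedCoveringMap [ConnectedSpace E] [LocallyPathConnectedSpace E]
    {x₀ : X} {h : p e₀ = x₀} {L : C(BasedPath x₀, E)} (hL : IsEndpointLift p h L) :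
    IsGeneralizedCoveringMap p := by
  refine ⟨‹_›, ‹_›, fun Y _ _ _ y₀ e f hf hle ↦ ?_⟩
  have : PathConnectedSpace E := .of_locallyPathConnectedSpace
  have : PathConnectedSpace Y := .of_locallyPathConnectedSpace
  exact (hL.comp_trans (PathConnectedSpace.somePath e₀ e)).existsUnique_lift f hf hle

end IsEndpointLift

end UniqueLifting

/-! ### Quotients of the based path space -/

section PathQuotient

open BasedPath

variable {X : Type*} [TopologicalSpace X] {x₀ x y : X}

/-- Paths from `x₀` with a common endpoint are identified if they differ by an element of `K`. -/
def basedPathSetoid (K : Subgroup (FundamentalGroup X x₀)) : Setoid (BasedPath x₀) where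
  r γ γ' := ∃ h : endpoint x₀ γ = endpoint x₀ γ',
    FundamentalGroup.fromPath (.mk (γ.path.trans (γ'.path.cast rfl h).symm)) ∈ K
  iseqv := by
    refine ⟨fun γ ↦ ⟨rfl, ?_⟩, ?_, ?_⟩
    · convert K.one_mem
      exact Path.Homotopic.Quotient.trans_symm (.mk γ.path)
    · rintro γ γ' ⟨h, hK⟩
      refine ⟨h.symm, ?_⟩
      obtain ⟨α, rfl⟩ := γ.exists_eq_of h
      convert K.inv_mem hK
      simp only [FundamentalGroup.inv_def, FundamentalGroup.fromPath,
        FundamentalGroup.fromArrow, ← Path.Homotopic.Quotient.mk_symm, Path.trans_symm,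
        Path.symm_symm]
      rfl
    · rintro γ γ' γ'' ⟨h, hK⟩ ⟨h', hK'⟩
      refine ⟨h.trans h', ?_⟩
      obtain ⟨α, rfl⟩ := γ.exists_eq_of (h.trans h')
      obtain ⟨α', rfl⟩ := γ'.exists_eq_of h'
      convert K.mul_mem hK' hK
      simp only [FundamentalGroup.mul_def, FundamentalGroup.fromPath,
        FundamentalGroup.fromArrow, Path.Homotopic.Quotient.mk_trans,
        Path.Homotopic.Quotient.mk_symm]
      grind

/-- The candidate for the total space of the generalized covering of `X` that belongs to `K`. -/
def PathQuotient (K : Subgroup (FundamentalGroup X x₀)) :=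
  Quotient (basedPathSetoid K)

namespace PathQuotient

variable (K : Subgroup (FundamentalGroup X x₀))

instance : TopologicalSpace (PathQuotient K) :=
  inferInstanceAs (TopologicalSpace (Quotient (basedPathSetoid K)))

instance : LocallyPathConnectedSpace (PathQuotient K) :=
  inferInstanceAs (LocallyPathConnectedSpace (Quotient (basedPathSetoid K)))

instance : PathConnectedSpace (PathQuotient K) :=
  inferInstanceAs (PathConnectedSpace (Quotient (basedPathSetoid K)))

/-- The class of a based path. -/
def mk : C(BasedPath x₀, PathQuotient K) :=
  ⟨Quotient.mk _, continuous_quot_mk⟩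

/-- The projection of a class of based paths to their common endpoint. -/
def proj : C(PathQuotient K, X) where
  toFun := Quotient.lift (endpoint x₀) fun _ _ h ↦ h.1
  continuous_toFun := (map_continuous _).quotient_lift _

@[simp]
theorem proj_mk (γ : BasedPath x₀) : proj K (mk K γ) = endpoint x₀ γ := rfl

theorem isQuotientMap_mk : IsQuotientMap (mk K) := isQuotientMap_quot_mk

variable {K}

theorem exists_mk_of_eq (e : PathQuotient K) (he : proj K e = x) :
    ∃ α : Path x₀ x, mk K (of α) = e := by
  obtain ⟨γ, rfl⟩ := (isQuotientMap_mk K).surjective e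
  exact (γ.exists_eq_of he).imp fun _ ↦ congrArg (mk K)

theorem mk_of_eq_mk_of_iff {α β : Path x₀ x} :
    mk K (of α) = mk K (of β) ↔ FundamentalGroup.fromPath (.mk (α.trans β.symm)) ∈ K := by
  refine (Quotient.eq (r := basedPathSetoid K)).trans ⟨fun ⟨_, hK⟩ ↦ hK, fun hK ↦ ⟨?_, hK⟩⟩
  rw [endpoint_of, endpoint_of]

theorem proj_mk_refl : proj K (mk K (of (.refl x₀))) = x₀ := endpoint_of _

theorem apply_map_proj {E : Type*} [TopologicalSpace E] {p : C(E, X)} {e₀ : E} {h : p e₀ = x₀}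
    {L : C(BasedPath x₀, E)} (hL : IsEndpointLift p h L)
    (hK : K ≤ (FundamentalGroup.mapOfEq p h).range) {Γ : BasedPath (mk K (of (.refl x₀)))}
    {γ : BasedPath x₀} (hγ : mk K γ = endpoint _ Γ) : L (map (proj K) proj_mk_refl Γ) = L γ := by
  have hfactor (γ γ' : BasedPath x₀) (hγ : mk K γ = mk K γ') : L γ = L γ' := by
    have hend : endpoint x₀ γ = endpoint x₀ γ' := congrArg (proj K) hγ
    obtain ⟨α, rfl⟩ := γ.exists_eq_of hend
    exact hL.apply_eq_apply_iff.2 (hK (mk_of_eq_mk_of_iff (β := γ'.path).1 hγ))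
  let coord : C(PathQuotient K, E) := (isQuotientMap_mk K).lift L hfactor
  have hcoord (γ : BasedPath x₀) : coord (mk K γ) = L γ :=
    DFunLike.congr_fun ((isQuotientMap_mk K).lift_comp L hfactor) γ
  have hp (e : PathQuotient K) : p (coord e) = proj K e := by
    obtain ⟨γ, rfl⟩ := (isQuotientMap_mk K).surjective e
    rw [hcoord, hL.apply_apply, proj_mk]
  have hcoord₀ : coord (mk K (of (.refl x₀))) = e₀ := (hcoord _).trans hL.apply_refl
  calc L (map (proj K) proj_mk_refl Γ) = L (map p h (map coord hcoord₀ Γ)) :=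
        congrArg L (ext fun t ↦ (hp (Γ.path t)).symm)
    _ = coord (endpoint _ Γ) := hL.apply_map _
    _ = L γ := by rw [← hγ, hcoord]

theorem isEndpointLift_mk_iInf {ι : Sort*} {E : ι → Type*} [∀ i, TopologicalSpace (E i)]
    {p : ∀ i, C(E i, X)} {e₀ : ∀ i, E i} {h : ∀ i, p i (e₀ i) = x₀}
    {L : ∀ i, C(BasedPath x₀, E i)} (hL : ∀ i, IsEndpointLift (p i) (h i) (L i)) :
    IsEndpointLift (proj (⨅ i, (FundamentalGroup.mapOfEq (p i) (h i)).range)) proj_mk_refl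
      (mk _) := by
  refine ⟨rfl, ContinuousMap.ext fun Γ ↦ ?_⟩
  obtain ⟨α, hα⟩ := exists_mk_of_eq (endpoint _ Γ) rfl
  obtain ⟨β, hβ⟩ := (map (proj _) proj_mk_refl Γ).exists_eq_of (endpoint_map ..)
  rw [ContinuousMap.comp_apply, ← hα, ← hβ, mk_of_eq_mk_of_iff, Subgroup.mem_iInf]
  intro i
  rw [← (hL i).apply_eq_apply_iff, hβ]
  exact apply_map_proj (hL i) (iInf_le _ i) hα

theorem range_mapOfEq_proj (hmk : IsEndpointLift (proj K) proj_mk_refl (mk K)) :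
    (FundamentalGroup.mapOfEq (proj K) proj_mk_refl).range = K := by
  ext g
  obtain ⟨γ, rfl⟩ := Path.Homotopic.Quotient.mk_surjective g
  refine hmk.apply_eq_iff.symm.trans (mk_of_eq_mk_of_iff.trans ?_)
  simp only [Path.refl_symm, Path.Homotopic.Quotient.mk_trans, Path.Homotopic.Quotient.mk_refl,
    Path.Homotopic.Quotient.trans_refl]

theorem mk_of_eq_of_homotopic {α β : Path x₀ x} (h : α.Homotopic β) :
    mk K (of α) = mk K (of β) := by
  rw [mk_of_eq_mk_of_iff, Path.Homotopic.Quotient.mk_trans, Path.Homotopic.Quotient.eq.2 h,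
    Path.Homotopic.Quotient.mk_symm, Path.Homotopic.Quotient.trans_symm]
  exact K.one_mem

theorem mk_of_trans_eq_mk_of_trans_iff {α β : Path x₀ x} (δ : Path x y) :
    mk K (of (α.trans δ)) = mk K (of (β.trans δ)) ↔ mk K (of α) = mk K (of β) := by
  have : Path.Homotopic.Quotient.mk ((α.trans δ).trans (β.trans δ).symm) =
      .mk (α.trans β.symm) := by
    simp only [Path.trans_symm, Path.Homotopic.Quotient.mk_trans,
      Path.Homotopic.Quotient.mk_symm]
    grind
  rw [mk_of_eq_mk_of_iff, mk_of_eq_mk_of_iff, this]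

theorem isOpenMap_proj [LocallyPathConnectedSpace X] : IsOpenMap (proj K) := by
  refine isOpenMap_iff_nhds_le.2 fun e ↦ ?_
  obtain ⟨α, hα⟩ := exists_mk_of_eq e rfl
  have hrefl : mk K (trans α (of (.refl _))) = e :=
    (congrArg (mk K) (BasedPath.trans_of ..)).trans
      ((mk_of_eq_of_homotopic ⟨Path.Homotopy.transRefl α⟩).trans hα)
  have hlim : Tendsto ((mk K).comp (trans α)) (𝓝 (of (.refl (proj K e)))) (𝓝 e) :=
    (((mk K).comp (trans α)).continuousAt (of (.refl _))).mono_right (congrArg 𝓝 hrefl).le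
  calc 𝓝 (proj K e) = Filter.map (endpoint _) (𝓝 (of (.refl (proj K e)))) :=
        (map_endpoint_nhds_refl _).symm
    _ = Filter.map (proj K) (Filter.map ((mk K).comp (trans α)) (𝓝 (of (.refl (proj K e))))) := by
        rw [Filter.map_map]
        exact congrArg₂ _ (funext fun ε ↦ (endpoint_trans α ε).symm) rfl
    _ ≤ Filter.map (proj K) (𝓝 e) := Filter.map_mono hlim

/-- The classes of the prolongations of `α` by paths in `V`: the sheet over `V` through the class
of `α`. -/
def sheet (K : Subgroup (FundamentalGroup X x₀)) (V : Set X) (α : Path x₀ x) :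
    Set (PathQuotient K) :=
  {e | ∃ (y : X) (δ : Path x y), range δ ⊆ V ∧ mk K (of (α.trans δ)) = e}

variable {V : Set X} {α : Path x₀ x}

theorem isOpen_sheet (hV : IsOpen V) : IsOpen (sheet K V α) := by
  refine (isQuotientMap_mk K).isOpen_preimage.1 (isOpen_iff_mem_nhds.2 ?_)
  rintro γ ⟨y, δ, hδ, hγ⟩
  obtain rfl : y = endpoint x₀ γ := by simpa using congrArg (proj K) hγ
  have hγV : endpoint x₀ γ ∈ V := hδ δ.target_mem_range
  filter_upwards [((hV.preimage (endpoint x₀).continuous).pathComponentIn γ).mem_nhds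
    (mem_pathComponentIn_self hγV)]
  rintro γ' ⟨Γ, hΓ⟩
  let ε : Path (endpoint x₀ γ) (endpoint x₀ γ') := Γ.map (endpoint x₀).continuous
  refine ⟨_, δ.trans ε, ?_, ?_⟩
  · rw [Path.trans_range]
    exact union_subset hδ (range_subset_iff.2 hΓ)
  calc mk K (of (α.trans (δ.trans ε))) = mk K (of ((α.trans δ).trans ε)) :=
        mk_of_eq_of_homotopic ⟨(Path.Homotopy.transAssoc α δ ε).symm⟩
    _ = mk K (of (γ.path.trans ε)) := (mk_of_trans_eq_mk_of_trans_iff ε).2 hγ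
    _ = mk K γ' := mk_of_eq_of_homotopic (path_trans_map_endpoint_homotopic Γ)

theorem surjOn_proj_sheet (hV : IsPathConnected V) (hx : x ∈ V) (α : Path x₀ x) :
    (sheet K V α).SurjOn (proj K) V := fun y hy ↦ by
  obtain ⟨δ, hδ⟩ := hV.joinedIn x hx y hy
  exact ⟨_, ⟨y, δ, range_subset_iff.2 hδ, rfl⟩, by simp⟩

theorem exists_mem_sheet (hV : IsPathConnected V) (hx : x ∈ V) {e : PathQuotient K}
    (he : proj K e ∈ V) : ∃ q : proj K ⁻¹' {x}, ∀ α : Path x₀ x, mk K (of α) = q →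
      e ∈ sheet K V α := by
  obtain ⟨γ, hγ⟩ := exists_mk_of_eq e rfl
  obtain ⟨δ, hδ⟩ := hV.joinedIn x hx _ he
  refine ⟨⟨mk K (of (γ.trans δ.symm)), endpoint_of _⟩, fun α hα ↦
    ⟨_, δ, range_subset_iff.2 hδ, ?_⟩⟩
  refine ((mk_of_trans_eq_mk_of_trans_iff δ).2 hα).trans
    ((mk_of_eq_of_homotopic (Path.Homotopic.Quotient.exact ?_)).trans hγ)
  simp only [Path.Homotopic.Quotient.mk_trans, Path.Homotopic.Quotient.mk_symm]
  grind

theorem mk_mem_sheet (hx : x ∈ V) (α : Path x₀ x) : mk K (of α) ∈ sheet K V α :=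
  ⟨x, .refl x, by simpa using hx, mk_of_eq_of_homotopic ⟨Path.Homotopy.transRefl α⟩⟩

section TransferOfLoops

variable (hK : ∀ (α : Path x₀ x) (β : Path x x), range β ⊆ V →
  FundamentalGroup.fromPath (.mk ((α.trans β).trans α.symm)) ∈ K)

include hK

theorem mk_of_trans_eq (α : Path x₀ x) {δ δ' : Path x y} (hδ : range δ ⊆ V) (hδ' : range δ' ⊆ V) :
    mk K (of (α.trans δ)) = mk K (of (α.trans δ')) := by
  rw [mk_of_eq_mk_of_iff]
  convert hK α (δ.trans δ'.symm) ?_ using 1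
  · simp only [Path.trans_symm, Path.Homotopic.Quotient.mk_trans,
      Path.Homotopic.Quotient.mk_symm]
    grind only [Path.Homotopic.Quotient.trans_assoc]
  · rw [Path.trans_range, Path.symm_range]
    exact union_subset hδ hδ'

theorem injOn_proj_sheet (α : Path x₀ x) : (sheet K V α).InjOn (proj K) := by
  rintro _ ⟨y, δ, hδ, rfl⟩ _ ⟨y', δ', hδ', rfl⟩ hyy'
  obtain rfl : y = y' := by simpa using hyy'
  exact mk_of_trans_eq hK α hδ hδ'

theorem disjoint_sheet {α α' : Path x₀ x} (hα : mk K (of α) ≠ mk K (of α')) :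
    Disjoint (sheet K V α) (sheet K V α') := by
  refine disjoint_left.2 ?_
  rintro _ ⟨y, δ, hδ, rfl⟩ ⟨y', δ', hδ', h⟩
  obtain rfl : y' = y := by simpa using congrArg (proj K) h
  exact hα ((mk_of_trans_eq_mk_of_trans_iff δ).1 (h.symm.trans (mk_of_trans_eq hK α' hδ' hδ)))

theorem discreteTopology_fiber (hV : IsOpen V) (hx : x ∈ V) :
    DiscreteTopology (proj K ⁻¹' {x}) := by
  refine discreteTopology_iff_isOpen_singleton.2 fun ⟨e, he⟩ ↦ ?_
  obtain ⟨α, rfl⟩ := exists_mk_of_eq e he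
  convert (isOpen_sheet (K := K) (α := α) hV).preimage continuous_subtype_val
  refine Eq.symm (eq_singleton_iff_unique_mem.2 ⟨mk_mem_sheet hx α, fun q hq ↦ ?_⟩)
  exact Subtype.ext (injOn_proj_sheet hK α hq (mk_mem_sheet hx α) (q.2.trans he.symm))

theorem isEvenlyCovered_proj [LocallyPathConnectedSpace X] (hV : IsOpen V)
    (hVc : IsPathConnected V) (hx : x ∈ V) :
    IsEvenlyCovered (proj K) x (proj K ⁻¹' {x}) := by
  choose α hα using fun q : proj K ⁻¹' {x} ↦ exists_mk_of_eq q.1 q.2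
  have hexh : proj K ⁻¹' V ⊆ ⋃ q, sheet K V (α q) := fun e he ↦ by
    obtain ⟨q, hq⟩ := exists_mem_sheet hVc hx he
    exact mem_iUnion.2 ⟨q, hq _ (hα q)⟩
  have := discreteTopology_fiber hK hV hx
  obtain hempty | hne := isEmpty_or_nonempty (proj K ⁻¹' {x})
  · refine .of_preimage_eq_empty _ (hV.mem_nhds hx) (eq_empty_of_forall_notMem fun e he ↦ ?_)
    simpa using hexh he
  have : Nonempty (X → PathQuotient K) := ⟨fun _ ↦ hne.some⟩
  refine IsEvenlyCovered.of_trivialization (t := hV.trivializationDiscrete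
    (fun q ↦ sheet K V (α q)) V (fun q W hW ↦ ⟨fun hWo ↦ ?_, fun hWo ↦ ?_⟩)
    (fun q ↦ injOn_proj_sheet hK (α q)) (fun q ↦ surjOn_proj_sheet hVc hx (α q))
    (fun q q' hq ↦ disjoint_sheet hK ?_) hexh) hx
  · exact (hWo.preimage (proj K).continuous).inter (isOpen_sheet hV)
  · rw [← inter_eq_left.2 (hW.trans (surjOn_proj_sheet hVc hx (α q))), ← image_preimage_inter]
    exact isOpenMap_proj _ hWo
  · rw [hα, hα]
    exact Subtype.coe_ne_coe.2 hq

end TransferOfLoops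

theorem isCoveringMap_proj [LocallyPathConnectedSpace X]
    (hK : ∀ x, ∃ V ∈ 𝓝 x, ∀ (α : Path x₀ x) (β : Path x x), range β ⊆ V →
      FundamentalGroup.fromPath (.mk ((α.trans β).trans α.symm)) ∈ K) :
    IsCoveringMap (proj K) := fun x ↦ by
  obtain ⟨V, hV, hVK⟩ := hK x
  have hx : x ∈ interior V := mem_interior_iff_mem_nhds.2 hV
  exact isEvenlyCovered_proj
    (fun α β hβ ↦ hVK α β (hβ.trans (pathComponentIn_subset.trans interior_subset)))
    (isOpen_interior.pathComponentIn x) (isPathConnected_pathComponentIn hx)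
    (mem_pathComponentIn_self hx)

end PathQuotient

end PathQuotient

/-! ### Covering subgroups -/

section CoveringSubgroups

open PathQuotient

variable {X : Type u} [TopologicalSpace X] {x₀ : X}

theorem locallyPathConnectedSpace_of_isLocalHomeomorph {E Y : Type*} [TopologicalSpace E]
    [TopologicalSpace Y] [LocallyPathConnectedSpace Y] {f : E → Y} (hf : IsLocalHomeomorph f) :
    LocallyPathConnectedSpace E := by
  choose chart hmem _ using hf
  let _ : ChartedSpace Y E := ⟨range chart, chart, hmem, mem_range_self⟩
  exact ChartedSpace.locallyPathConnectedSpace Y E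

theorem isGeneralizedCoveringSubgroup_iInf {ι : Sort*} {K : ι → Subgroup (FundamentalGroup X x₀)}
    (hK : ∀ i, IsGeneralizedCoveringSubgroup (K i)) :
    IsGeneralizedCoveringSubgroup (⨅ i, K i) := by
  choose E _ p e₀ h hp hrange using hK
  choose L hL using fun i ↦ (hp i).hasUniqueLiftingProperty.exists_isEndpointLift (h i)
  obtain rfl : (fun i ↦ (FundamentalGroup.mapOfEq (p i) (h i)).range) = K := funext hrange
  have hmk := isEndpointLift_mk_iInf hL
  exact ⟨_, _, proj _, _, proj_mk_refl, hmk.isGeneralizedCoveringMap, range_mapOfEq_proj hmk⟩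

theorem IsCoveringSubgroup.isGeneralizedCoveringSubgroup [LocallyPathConnectedSpace X]
    {K : Subgroup (FundamentalGroup X x₀)} (hK : IsCoveringSubgroup K) :
    IsGeneralizedCoveringSubgroup K := by
  obtain ⟨E, _, p, e₀, rfl, _, hp, hrange⟩ := hK
  have : LocallyPathConnectedSpace E :=
    locallyPathConnectedSpace_of_isLocalHomeomorph hp.isLocalHomeomorph
  obtain ⟨L, ⟨hL₀, hL⟩, -⟩ := hp.existsUnique_continuousMap_lifts (BasedPath.endpoint (p e₀))
    (.of (.refl _)) e₀ (BasedPath.endpoint_of _).symm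
  exact ⟨E, _, p, e₀, rfl, (IsEndpointLift.of_isCoveringMap hp (h := rfl)
    (DFunLike.coe_injective hL) hL₀).isGeneralizedCoveringMap, hrange⟩

theorem isCoveringSubgroup_of_forall_exists_nhds {X : Type u} [TopologicalSpace X]
    [LocallyPathConnectedSpace X] {x₀ : X} {K : Subgroup (FundamentalGroup X x₀)}
    (hK : ∀ x, ∃ V ∈ 𝓝 x, ∀ (α : Path x₀ x) (β : Path x x), range β ⊆ V →
      FundamentalGroup.fromPath (.mk ((α.trans β).trans α.symm)) ∈ K) :
    IsCoveringSubgroup K :=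
  have hcov := PathQuotient.isCoveringMap_proj hK
  ⟨PathQuotient K, _, PathQuotient.proj K, _, PathQuotient.proj_mk_refl, inferInstance, hcov,
    PathQuotient.range_mapOfEq_proj (.of_isCoveringMap hcov rfl rfl)⟩

end CoveringSubgroups

/-! ### Small loop transfer -/

/-- The subgroup of the classes of the loops in a set. -/
def smallLoopSubgroup {X : Type*} [TopologicalSpace X] {x₀ : X} {U : Set X} (hU : x₀ ∈ U) :
    Subgroup (FundamentalGroup X x₀) where
  carrier := {g | ∃ γ : Path x₀ x₀, range γ ⊆ U ∧ FundamentalGroup.fromPath (.mk γ) = g}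
  mul_mem' := by
    rintro _ _ ⟨γ, hγ, rfl⟩ ⟨γ', hγ', rfl⟩
    exact ⟨γ'.trans γ, by rw [Path.trans_range]; exact union_subset hγ' hγ, rfl⟩
  one_mem' := ⟨.refl x₀, by simpa using hU, rfl⟩
  inv_mem' := by
    rintro _ ⟨γ, hγ, rfl⟩
    exact ⟨γ.symm, by rwa [Path.symm_range], rfl⟩

/-- The lifts of a loop in the class `g` and of a small loop `ν` with `g ∈ [ν] H` have the same
endpoint, which is therefore close to `e₀`. -/
theorem IsGeneralizedCoveringSubgroup.mem_of_forall_exists_mul_eq {X : Type u}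
    [TopologicalSpace X] {x₀ : X} {H : Subgroup (FundamentalGroup X x₀)}
    (hH : IsGeneralizedCoveringSubgroup H) {g : FundamentalGroup X x₀}
    (hg : ∀ U, ∀ hU : U ∈ 𝓝 x₀, ∃ n ∈ smallLoopSubgroup (mem_of_mem_nhds hU), ∃ h ∈ H, n * h = g) :
    g ∈ H := by
  obtain ⟨E, _, p, e₀, h, hp, rfl⟩ := hH
  obtain ⟨L, hL⟩ := hp.hasUniqueLiftingProperty.exists_isEndpointLift h
  obtain ⟨γ, rfl⟩ := Path.Homotopic.Quotient.mk_surjective g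
  have hspec : L (.of γ) ⤳ e₀ := specializes_iff_pure.2 fun W hW ↦ by
    obtain ⟨U, hU, hUW⟩ := BasedPath.exists_forall_of_mem
      (L.continuousAt (.of (.refl x₀)) (by rwa [hL.apply_refl]))
    obtain ⟨_, ⟨ν, hν, rfl⟩, k, hk, hνk⟩ := hg U hU
    have hγν : L (.of γ) = L (.of ν) := by
      rw [hL.apply_eq_apply_iff]
      convert hk
      rw [← inv_mul_eq_iff_eq_mul.2 hνk.symm]
      rfl
    exact mem_pure.2 (hγν ▸ hUW (.of ν) hν)
  exact hL.apply_eq_iff.1 (hL.eq_of_specializes hspec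
    ((hL.apply_apply _).trans (BasedPath.endpoint_of γ)))

namespace IsStrongSLTAt

variable {X : Type u} [TopologicalSpace X] {x₀ : X}

theorem isCoveringSubgroup_of_smallLoopSubgroup_le [LocallyPathConnectedSpace X]
    (hX : IsStrongSLTAt x₀) {U : Set X} (hU : U ∈ 𝓝 x₀) {K : Subgroup (FundamentalGroup X x₀)}
    (hK : smallLoopSubgroup (mem_of_mem_nhds hU) ≤ K) : IsCoveringSubgroup K :=
  isCoveringSubgroup_of_forall_exists_nhds fun x ↦ by
    obtain ⟨V, hV, htransfer⟩ := hX x U hU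
    refine ⟨V, hV, fun α β hβ ↦ ?_⟩
    obtain ⟨γ, hγU, hγ⟩ := htransfer α β hβ
    exact hK ⟨γ, hγU, Path.Homotopic.Quotient.eq.2 hγ⟩

theorem exists_normalClosure_le (hX : IsStrongSLTAt x₀) {U : Set X} (hU : U ∈ 𝓝 x₀) :
    ∃ V, ∃ hV : V ∈ 𝓝 x₀, Subgroup.normalClosure
      (smallLoopSubgroup (mem_of_mem_nhds hV) : Set (FundamentalGroup X x₀)) ≤
        smallLoopSubgroup (mem_of_mem_nhds hU) := by
  obtain ⟨V, hV, htransfer⟩ := hX x₀ U hU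
  refine ⟨V, hV, (Subgroup.closure_le _).2 fun g hg ↦ ?_⟩
  obtain ⟨_, ⟨β, hβ, rfl⟩, hconj⟩ := Group.mem_conjugatesOfSet_iff.1 hg
  obtain ⟨c, rfl⟩ := isConj_iff.1 hconj
  obtain ⟨α, rfl⟩ := Path.Homotopic.Quotient.mk_surjective c
  obtain ⟨γ, hγU, hγ⟩ := htransfer α.symm β hβ
  refine ⟨γ, hγU, ?_⟩
  rw [Path.Homotopic.Quotient.eq.2 hγ]
  simp only [FundamentalGroup.mul_def, FundamentalGroup.inv_def, FundamentalGroup.fromPath,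
    FundamentalGroup.fromArrow, Path.Homotopic.Quotient.mk_trans,
    Path.Homotopic.Quotient.mk_symm, Path.symm_symm]
  grind

theorem exists_mul_eq_of_mem_sInf [LocallyPathConnectedSpace X] (hX : IsStrongSLTAt x₀)
    {H : Subgroup (FundamentalGroup X x₀)} {g : FundamentalGroup X x₀}
    (hg : g ∈ sInf {K : Subgroup (FundamentalGroup X x₀) | IsCoveringSubgroup K ∧ H ≤ K})
    {U : Set X} (hU : U ∈ 𝓝 x₀) :
    ∃ n ∈ smallLoopSubgroup (mem_of_mem_nhds hU), ∃ h ∈ H, n * h = g := by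
  obtain ⟨V, hV, hVU⟩ := hX.exists_normalClosure_le hU
  let N := Subgroup.normalClosure
    (smallLoopSubgroup (mem_of_mem_nhds hV) : Set (FundamentalGroup X x₀))
  have hcov : IsCoveringSubgroup (N ⊔ H) := hX.isCoveringSubgroup_of_smallLoopSubgroup_le hV
    (Subgroup.subset_normalClosure.trans (SetLike.coe_subset_coe.2 le_sup_left))
  obtain ⟨n, hn, h, hh, hnh⟩ :=
    (Subgroup.mem_sup_of_normal_left ..).1 (Subgroup.mem_sInf.1 hg _ ⟨hcov, le_sup_right⟩)
  exact ⟨n, hVU hn, h, hh, hnh⟩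

end IsStrongSLTAt

theorem mainTheorem6_general {X : Type*} [TopologicalSpace X] [LocallyPathConnectedSpace X]
    (x₀ : X) (hX : IsStrongSLTAt x₀) (H : Subgroup (FundamentalGroup X x₀)) :
    IsGeneralizedCoveringSubgroup H ↔
      H = sInf {K : Subgroup (FundamentalGroup X x₀) | IsCoveringSubgroup K ∧ H ≤ K} := by
  constructor
  · intro hH
    refine le_antisymm (le_sInf fun K hK ↦ hK.2) fun g hg ↦ ?_
    exact hH.mem_of_forall_exists_mul_eq fun U hU ↦ hX.exists_mul_eq_of_mem_sInf hg hU
  · intro hH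
    rw [hH, sInf_eq_iInf']
    exact isGeneralizedCoveringSubgroup_iInf fun K ↦ K.2.1.isGeneralizedCoveringSubgroup

theorem mainTheorem6 {X : Type*} [TopologicalSpace X] [ConnectedSpace X]
    [LocallyPathConnectedSpace X] (x₀ : X) (hX : IsStrongSLTAt x₀)
    (H : Subgroup (FundamentalGroup X x₀)) :
    IsGeneralizedCoveringSubgroup H ↔
      H = sInf {K : Subgroup (FundamentalGroup X x₀) | IsCoveringSubgroup K ∧ H ≤ K} :=
  mainTheorem6_general x₀ hX H
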